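/- Conventions. A unitary multitensor category is a semisimple rigid tensor C*-category. A unitary dual functor $\vee$ on it is a choice, for every object $c$, of a dual $(c^\vee, \mathrm{ev}_c: c^\vee\otimes c\to 1, \mathrm{coev}_c: 1\to c\otimes c^\vee)$ such that $f^{\vee\dagger}=f^{\dagger\vee}$ for all morphisms $f$ and the canonical isomorphisms $\nu_{a,b}: a^\vee\otimes b^\vee\to(b\otimes a)^\vee$ are unitary. It induces the pivotal structure $\varphi_c=(\mathrm{coev}_c^\dagger\otimes 1)\circ(1\otimes\mathrm{coev}_{c^\vee}): c\to c^{\vee\vee}$ and the $\mathrm{End}(1)$-valued traces $\mathrm{tr}_L(f)=\mathrm{ev}_c\circ(1\otimes f)\circ\mathrm{ev}_c^\dagger$ and $\mathrm{tr}_R(f)=\mathrm{coev}_c^\dagger\circ(f\otimes 1)\circ\mathrm{coev}_c$ for $f\in\mathrm{End}(c)$. Let $\mathcal V$ be a braided unitary tensor category (a unitary multitensor category with simple unit object and a unitary braiding) with a unitary dual functor $\vee_{\mathcal V}$. Let $(\mathcal C,\vee_{\mathcal C},\psi_{\mathcal C},\Phi^{\mathcal Z})$ be a unitary module multitensor category over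 $\mathcal V$, that is: a unitary multitensor category $\mathcal C$ with a unitary dual functor $\vee_{\mathcal C}$, a faithful state $\psi_{\mathcal C}$ on $\mathrm{End}_{\mathcal C}(1_{\mathcal C})$, and a braided pivotal dagger tensor functor $\Phi^{\mathcal Z}:\mathcal V\to\mathcal Z^\dagger(\mathcal C)$ to the unitary Drinfeld center (the full subcategory of the Drinfeld center of objects with unitary half-braiding). Write $\Phi:\mathcal V\to\mathcal C$ for the composite of $\Phi^{\mathcal Z}$ with the forgetful functor and $e_{\Phi(v),x}:\Phi(v)\otimes x\to x\otimes\Phi(v)$ for the half-braidings. Let $\mathbf{Tr}_{\mathcal V}:\mathcal C\to\mathcal V$ be a unitary right adjoint of $\Phi$, that is, a right adjoint for which the bijections $\mathcal C(\Phi(v)\to c)\cong\mathcal V(v\to\mathbf{Tr}_{\mathcal V}(c))$ are unitary for the inner products $\langle f,g\rangle=\psi_{\mathcal C}(\mathrm{tr}_R^{\mathcal C}(g^\dagger f))$ and $\langle f,g\rangle=\mathrm{tr}_R^{\mathcal V}(g^\dagger f)\in\mathrm{End}_{\mathcal V}(1_{\mathcal V})\cong\mathbb C$; let $\varepsilon$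 be the counit. For $a,b\in\mathcal C$, the traciator $\tau_{a,b}:\mathbf{Tr}_{\mathcal V}(a\otimes b)\to\mathbf{Tr}_{\mathcal V}(b\otimes a)$ is the morphism that corresponds under the adjunction to $$(1_{b\otimes a}\otimes\mathrm{coev}_b^\dagger)\circ(1_b\otimes\varepsilon_{a\otimes b}\otimes 1_{b^\vee})\circ(e_{\Phi(\mathbf{Tr}_{\mathcal V}(a\otimes b)),b}\otimes 1_{b^\vee})\circ(1\otimes\mathrm{coev}_b):\ \Phi(\mathbf{Tr}_{\mathcal V}(a\otimes b))\to b\otimes a .$$ Proposition. If $\psi_{\mathcal C}$ is spherical, i.e. $\psi_{\mathcal C}(\mathrm{tr}_L(f))=\psi_{\mathcal C}(\mathrm{tr}_R(f))$ for every object $c\in\mathcal C$ and every $f\in\mathrm{End}_{\mathcal C}(c)$, then $\tau_{a,b}$ is unitary (in particular invertible) for all $a,b\in\mathcal C$. -/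

import Mathlib

open CategoryTheory MonoidalCategory
open scoped ComplexOrder

noncomputable section

namespace UnitaryTraciator

universe v u v₁ u₁ v₂ u₂

/-! ### Dagger categories and C*-categories -/

/-- A dagger structure on a category: an identity-on-objects involutive contravariant functor. -/
class DaggerCategory (C : Type u) [Category.{v} C] where
  dag : ∀ {X Y : C}, (X ⟶ Y) → (Y ⟶ X)
  dag_id : ∀ X : C, dag (𝟙 X) = 𝟙 X
  dag_comp : ∀ {X Y Z : C} (f : X ⟶ Y) (g : Y ⟶ Z), dag (f ≫ g) = dag g ≫ dag f
  dag_dag : ∀ {X Y : C} (f : X ⟶ Y), dag (dag f) = f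

open DaggerCategory (dag)

/-- A morphism `f` is unitary if `f† f = id` and `f f† = id`. -/
def IsUnitary {C : Type u} [Category.{v} C] [DaggerCategory C] {X Y : C} (f : X ⟶ Y) : Prop :=
  f ≫ dag f = 𝟙 X ∧ dag f ≫ f = 𝟙 Y

/-- A family of complete, submultiplicative norms on the hom spaces of a `ℂ`-linear dagger category
that satisfies the C*-identity `‖f† f‖ = ‖f‖²`. -/
structure IsCStarNorm (C : Type u) [Category.{v} C] [Preadditive C] [Linear ℂ C]
    [DaggerCategory C] (N : ∀ X Y : C, (X ⟶ Y) → ℝ) : Prop where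
  eq_zero : ∀ (X Y : C) (f : X ⟶ Y), N X Y f = 0 → f = 0
  add_le : ∀ (X Y : C) (f g : X ⟶ Y), N X Y (f + g) ≤ N X Y f + N X Y g
  smul : ∀ (X Y : C) (c : ℂ) (f : X ⟶ Y), N X Y (c • f) = ‖c‖ * N X Y f
  comp_le : ∀ (X Y Z : C) (f : X ⟶ Y) (g : Y ⟶ Z), N X Z (f ≫ g) ≤ N X Y f * N Y Z g
  cstar : ∀ (X Y : C) (f : X ⟶ Y), N X X (f ≫ dag f) = N X Y f ^ 2
  complete : ∀ (X Y : C) (s : ℕ → (X ⟶ Y)),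
    (∀ r : ℝ, 0 < r → ∃ n₀ : ℕ, ∀ m n : ℕ, n₀ ≤ m → n₀ ≤ n → N X Y (s m - s n) < r) →
    ∃ f : X ⟶ Y, ∀ r : ℝ, 0 < r → ∃ n₀ : ℕ, ∀ n : ℕ, n₀ ≤ n → N X Y (s n - f) < r

/-- A C*-category: the dagger is antilinear, the hom spaces carry C*-norms, and each `f† f` is a
positive element of the C*-algebra of endomorphisms of the source of `f`. -/
class IsCStarCategory (C : Type u) [Category.{v} C] [Preadditive C] [Linear ℂ C]
    [DaggerCategory C] : Prop where
  dag_add : ∀ {X Y : C} (f g : X ⟶ Y), dag (f + g) = dag f + dag g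
  dag_smul : ∀ {X Y : C} (c : ℂ) (f : X ⟶ Y), dag (c • f) = (starRingEnd ℂ) c • dag f
  exists_norm : ∃ N : ∀ X Y : C, (X ⟶ Y) → ℝ, IsCStarNorm C N
  positive : ∀ {X Y : C} (f : X ⟶ Y), ∃ g : X ⟶ X, f ≫ dag f = g ≫ dag g

/-! ### Unitary multitensor categories -/

/-- A unitary multitensor category, i.e. a semisimple rigid tensor C*-category. Semisimplicity is
expressed as: finite dimensional hom spaces, finite direct sums, and splitting of idempotents. -/
class IsUnitaryMultitensorCategory (C : Type u) [Category.{v} C] [Preadditive C] [Linear ℂ C]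
    [MonoidalCategory C] [MonoidalPreadditive C] [MonoidalLinear ℂ C] [DaggerCategory C] : Prop
    extends IsCStarCategory C where
  finite_hom : ∀ X Y : C, Module.Finite ℂ (X ⟶ Y)
  hasFiniteBiproducts : Limits.HasFiniteBiproducts C
  idempotentComplete : IsIdempotentComplete C
  dag_tensor : ∀ {X Y X' Y' : C} (f : X ⟶ Y) (g : X' ⟶ Y'),
    dag (MonoidalCategoryStruct.tensorHom f g) = MonoidalCategoryStruct.tensorHom (dag f) (dag g)
  associator_unitary : ∀ X Y Z : C, IsUnitary (α_ X Y Z).hom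
  leftUnitor_unitary : ∀ X : C, IsUnitary (λ_ X).hom
  rightUnitor_unitary : ∀ X : C, IsUnitary (ρ_ X).hom
  rigid : ∀ X : C, Nonempty (HasLeftDual X) ∧ Nonempty (HasRightDual X)

/-- A braided unitary tensor category: a unitary multitensor category with simple unit object and a
unitary braiding. -/
class IsBraidedUnitaryTensorCategory (V : Type u) [Category.{v} V] [Preadditive V] [Linear ℂ V]
    [MonoidalCategory V] [MonoidalPreadditive V] [MonoidalLinear ℂ V] [DaggerCategory V]
    [BraidedCategory V] : Prop extends IsUnitaryMultitensorCategory V where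
  simple_unit : Simple (𝟙_ V)
  braiding_unitary : ∀ X Y : V, IsUnitary (β_ X Y).hom

/-! ### Unitary dual functors, pivotal structure, traces -/

section Duals

variable {C : Type u} [Category.{v} C] [MonoidalCategory C] [RightRigidCategory C]

/-- The coevaluation `1 ⟶ c ⊗ c^∨` of the chosen dual of `c`. -/
def coev (c : C) : 𝟙_ C ⟶ c ⊗ cᘁ := η_ c cᘁ

/-- The evaluation `c^∨ ⊗ c ⟶ 1` of the chosen dual of `c`. -/
def ev (c : C) : cᘁ ⊗ c ⟶ 𝟙_ C := ε_ c cᘁ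

/-- The tensorator `ν_{a,b} : a^∨ ⊗ b^∨ ⟶ (b ⊗ a)^∨` of the dual functor:
`(ev_a ⊗ 1) ∘ (1 ⊗ ev_b ⊗ 1 ⊗ 1) ∘ (1 ⊗ 1 ⊗ coev_{b ⊗ a})`. -/
def dualTensorator (a b : C) : aᘁ ⊗ bᘁ ⟶ (b ⊗ a)ᘁ :=
  (ρ_ (aᘁ ⊗ bᘁ)).inv ≫ (aᘁ ⊗ bᘁ) ◁ coev (b ⊗ a) ≫ (α_ aᘁ bᘁ ((b ⊗ a) ⊗ (b ⊗ a)ᘁ)).hom ≫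
    aᘁ ◁ (bᘁ ◁ (α_ b a (b ⊗ a)ᘁ).hom ≫ (α_ bᘁ b (a ⊗ (b ⊗ a)ᘁ)).inv ≫
      ev b ▷ (a ⊗ (b ⊗ a)ᘁ) ≫ (λ_ (a ⊗ (b ⊗ a)ᘁ)).hom) ≫
    (α_ aᘁ a (b ⊗ a)ᘁ).inv ≫ ev a ▷ (b ⊗ a)ᘁ ≫ (λ_ (b ⊗ a)ᘁ).hom

variable (C) in
/-- The chosen duals form a unitary dual functor: `f^{∨†} = f^{†∨}` and each `ν_{a,b}` is
unitary. -/
class IsUnitaryDualFunctor [DaggerCategory C] : Prop where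
  dag_dual : ∀ {a b : C} (f : a ⟶ b), dag (fᘁ) = (dag f)ᘁ
  tensorator_unitary : ∀ a b : C, IsUnitary (dualTensorator a b)

variable [DaggerCategory C]

/-- The canonical pivotal structure `φ_c = (coev_c† ⊗ 1) ∘ (1 ⊗ coev_{c^∨}) : c ⟶ c^∨∨`. -/
def pivotalMap (c : C) : c ⟶ (cᘁ)ᘁ :=
  (ρ_ c).inv ≫ c ◁ coev (cᘁ) ≫ (α_ c (cᘁ) ((cᘁ)ᘁ)).inv ≫ dag (coev c) ▷ (cᘁ)ᘁ ≫ (λ_ ((cᘁ)ᘁ)).hom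

/-- The left trace `tr_L(f) = ev_c ∘ (1 ⊗ f) ∘ ev_c†`, with values in `End(1)`. -/
def trL {c : C} (f : c ⟶ c) : 𝟙_ C ⟶ 𝟙_ C := dag (ev c) ≫ cᘁ ◁ f ≫ ev c

/-- The right trace `tr_R(f) = coev_c† ∘ (f ⊗ 1) ∘ coev_c`, with values in `End(1)`. -/
def trR {c : C} (f : c ⟶ c) : 𝟙_ C ⟶ 𝟙_ C := coev c ≫ f ▷ cᘁ ≫ dag (coev c)

end Duals

section States

variable {C : Type u} [Category.{v} C] [Preadditive C] [Linear ℂ C] [MonoidalCategory C]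
  [DaggerCategory C]

/-- A faithful state on the C*-algebra `End(1)`. -/
structure IsFaithfulState (ψ : (𝟙_ C ⟶ 𝟙_ C) →ₗ[ℂ] ℂ) : Prop where
  map_one : ψ (𝟙 (𝟙_ C)) = 1
  nonneg : ∀ f : 𝟙_ C ⟶ 𝟙_ C, 0 ≤ ψ (f ≫ dag f)
  faithful : ∀ f : 𝟙_ C ⟶ 𝟙_ C, ψ (f ≫ dag f) = 0 → f = 0

/-- The state `ψ` is spherical with respect to the chosen duals: `ψ ∘ tr_L = ψ ∘ tr_R`. -/
def IsSpherical [RightRigidCategory C] (ψ : (𝟙_ C ⟶ 𝟙_ C) →ₗ[ℂ] ℂ) : Prop :=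
  ∀ (c : C) (f : c ⟶ c), ψ (trL f) = ψ (trR f)

end States

/-! ### Pivotal dagger tensor functors -/

section Functors

variable {V : Type u₁} [Category.{v₁} V] [MonoidalCategory V]
  {C : Type u₂} [Category.{v₂} C] [MonoidalCategory C]

/-- A dagger tensor functor: `ℂ`-linear, dagger preserving, with unitary structure maps. -/
structure IsDaggerTensorFunctor [Preadditive V] [Linear ℂ V] [Preadditive C] [Linear ℂ C]
    [DaggerCategory V] [DaggerCategory C] (F : V ⥤ C) [F.Monoidal] : Prop where
  map_add : ∀ {v w : V} (f g : v ⟶ w), F.map (f + g) = F.map f + F.map g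
  map_smul : ∀ {v w : V} (c : ℂ) (f : v ⟶ w), F.map (c • f) = c • F.map f
  map_dag : ∀ {v w : V} (f : v ⟶ w), F.map (dag f) = dag (F.map f)
  unit_unitary : IsUnitary (Functor.LaxMonoidal.ε F)
  tensorator_unitary : ∀ v w : V, IsUnitary (Functor.LaxMonoidal.μ F v w)

variable [RightRigidCategory V] [RightRigidCategory C]

/-- The canonical map `χ_v = (F(ev_v) ⊗ 1) ∘ (1 ⊗ coev_{F(v)}) : F(v^∨) ⟶ F(v)^∨`. -/
def dualComparison (F : V ⥤ C) [F.Monoidal] (v : V) : F.obj (vᘁ) ⟶ (F.obj v)ᘁ :=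
  (ρ_ (F.obj (vᘁ))).inv ≫ F.obj (vᘁ) ◁ coev (F.obj v) ≫
    (α_ (F.obj (vᘁ)) (F.obj v) (F.obj v)ᘁ).inv ≫
    (Functor.LaxMonoidal.μ F (vᘁ) v ≫ F.map (ev v) ≫ Functor.OplaxMonoidal.η F) ▷ (F.obj v)ᘁ ≫
    (λ_ (F.obj v)ᘁ).hom

/-- A monoidal functor is pivotal if `χ_v^∨ ∘ φ_{F(v)} = χ_{v^∨} ∘ F(φ_v)` for all `v`. -/
def IsPivotalFunctor [DaggerCategory V] [DaggerCategory C] (F : V ⥤ C) [F.Monoidal] : Prop :=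
  ∀ v : V, pivotalMap (F.obj v) ≫ (dualComparison F v)ᘁ =
    F.map (pivotalMap v) ≫ dualComparison F (vᘁ)

end Functors

/-! ### Unitary module multitensor categories and the traciator -/

section ModuleCategories

variable (V : Type u₁) [Category.{v₁} V] [Preadditive V] [Linear ℂ V] [MonoidalCategory V]
  [DaggerCategory V] [BraidedCategory V] [RightRigidCategory V]
  (C : Type u₂) [Category.{v₂} C] [Preadditive C] [Linear ℂ C] [MonoidalCategory C]
  [DaggerCategory C] [RightRigidCategory C]

/-- The structure of a unitary module multitensor category over `V` on a unitary multitensor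
category `C` with a unitary dual functor: a faithful state `ψ` on `End(1_C)`, and a braided pivotal
dagger tensor functor `ΦZ` from `V` to the unitary Drinfeld center, i.e. to the full subcategory of
the Drinfeld center on the objects whose half-braiding is unitary. The linear structure, the dagger
and the duals of the unitary Drinfeld center are those of `C`, so the conditions on `ΦZ` that
involve them are imposed on its composite with the forgetful functor to `C`. -/
structure UnitaryModuleStructure where
  ψ : (𝟙_ C ⟶ 𝟙_ C) →ₗ[ℂ] ℂ
  faithfulState : IsFaithfulState ψ
  ΦZ : V ⥤ Center C
  braided : ΦZ.Braided
  halfBraiding_unitary : ∀ (v : V) (x : C), IsUnitary ((ΦZ.obj v).2.β x).hom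
  daggerTensor : IsDaggerTensorFunctor (ΦZ ⋙ Center.forget C)
  pivotal : IsPivotalFunctor (ΦZ ⋙ Center.forget C)

variable {V C}

namespace UnitaryModuleStructure

variable (M : UnitaryModuleStructure V C)

/-- The underlying functor `Φ : V ⥤ C` of `ΦZ`. -/
def Φ : V ⥤ C := M.ΦZ ⋙ Center.forget C

/-- The half-braiding `e_{Φ(v),x} : Φ(v) ⊗ x ⟶ x ⊗ Φ(v)`. -/
def halfBraiding (v : V) (x : C) : M.Φ.obj v ⊗ x ⟶ x ⊗ M.Φ.obj v := ((M.ΦZ.obj v).2.β x).hom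

/-- An adjunction `Φ ⊣ Tr` is unitary if the bijections `C(Φ(v) ⟶ c) ≃ V(v ⟶ Tr(c))` preserve the
inner products `⟨f, g⟩ = ψ(tr_R(g† f))` on the hom spaces of `C` and `⟨f, g⟩ = tr_R(g† f)` on those
of `V`; here the endomorphisms of the simple object `1_V` are identified with scalars. -/
def IsUnitaryAdjunction {Tr : C ⥤ V} (adj : M.Φ ⊣ Tr) : Prop :=
  ∀ (v : V) (c : C) (f g : M.Φ.obj v ⟶ c),
    trR (adj.homEquiv v c f ≫ dag (adj.homEquiv v c g)) =
      M.ψ (trR (f ≫ dag g)) • 𝟙 (𝟙_ V)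

/-- The morphism `Φ(Tr(a ⊗ b)) ⟶ b ⊗ a` given by
`(1 ⊗ 1 ⊗ coev_b†) ∘ (1 ⊗ ε_{a ⊗ b} ⊗ 1) ∘ (e_{Φ(Tr(a ⊗ b)), b} ⊗ 1) ∘ (1 ⊗ coev_b)`, where `ε` is
the counit of the adjunction. -/
def traciatorMate {Tr : C ⥤ V} (adj : M.Φ ⊣ Tr) (a b : C) :
    M.Φ.obj (Tr.obj (a ⊗ b)) ⟶ b ⊗ a :=
  (ρ_ (M.Φ.obj (Tr.obj (a ⊗ b)))).inv ≫ M.Φ.obj (Tr.obj (a ⊗ b)) ◁ coev b ≫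
    (α_ (M.Φ.obj (Tr.obj (a ⊗ b))) b bᘁ).inv ≫
    M.halfBraiding (Tr.obj (a ⊗ b)) b ▷ bᘁ ≫
    (b ◁ adj.counit.app (a ⊗ b)) ▷ bᘁ ≫
    (α_ b (a ⊗ b) bᘁ).hom ≫ b ◁ ((α_ a b bᘁ).hom ≫ a ◁ dag (coev b) ≫ (ρ_ a).hom)

/-- The traciator `τ_{a,b} : Tr(a ⊗ b) ⟶ Tr(b ⊗ a)`: the mate of `traciatorMate` under the
adjunction. -/
def traciator {Tr : C ⥤ V} (adj : M.Φ ⊣ Tr) (a b : C) : Tr.obj (a ⊗ b) ⟶ Tr.obj (b ⊗ a) :=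
  adj.homEquiv (Tr.obj (a ⊗ b)) (b ⊗ a) (M.traciatorMate adj a b)

end UnitaryModuleStructure

end ModuleCategories

end UnitaryTraciator

end

/-!
The traciator represents a rotation. For a half-braiding of `x`, `rotate` sends `f : x ⟶ a ⊗ b` to
the morphism `x ⟶ b ⊗ a` in which the leg `b` is carried around `x`, and by naturality of the
half-braidings post-composition with `τ_{a,b}` corresponds, under `Φ ⊣ Tr`, to the rotation of
morphisms `Φ(v) ⟶ a ⊗ b` (`homEquiv_comp_traciator`).

The rotation preserves the inner product `ψ(tr_R(f f'†))` (`IsSpherical.map_trR_rotate`). Passing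
`Φ(v)` across the cup `coev_b` writes it as three moves (`rotate_eq_bendLeft`): bend `b` down on the
right, compose with a unitary half-braiding, bend `b^∨` up on the left. The first two are isometric
because `tr_R` is tracial (`trR_comp_comm`) and compatible with partial traces (`trR_ptrR`). The
third one is isometric by sphericality (`IsSpherical.map_trR_dual`), together with the formula
`tr_R(P) = ev_b (P ⊗ 1) ev_b†` for `P : b^∨ ⟶ b^∨` (`trR_dual`).

As the trace of `V` is faithful, `τ† τ = 1`. So composition with `τ_{a,b}` and with `τ_{b,a}` is
injective on the finite dimensional Hom spaces of `V`; these have equal dimension, composition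
with `τ_{a,b}` is also surjective, and `τ_{a,b}` is unitary.
-/

namespace UnitaryTraciator

open DaggerCategory (dag)

/-! ### The dagger on the structure morphisms -/

section Dagger

variable {C : Type*} [Category C] [DaggerCategory C]

theorem dag_hom_of_isUnitary {X Y : C} {f : X ≅ Y} (h : IsUnitary f.hom) :
    dag f.hom = f.inv := by
  rw [← cancel_epi f.hom, h.1, f.hom_inv_id]

theorem dag_inv_of_isUnitary {X Y : C} {f : X ≅ Y} (h : IsUnitary f.hom) :
    dag f.inv = f.hom := by
  rw [← dag_hom_of_isUnitary h, DaggerCategory.dag_dag]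

attribute [simp] DaggerCategory.dag_id DaggerCategory.dag_comp DaggerCategory.dag_dag

variable [Preadditive C] [Linear ℂ C]
  [MonoidalCategory C] [MonoidalPreadditive C] [MonoidalLinear ℂ C]
  [IsUnitaryMultitensorCategory C]

@[simp]
theorem dag_associator_hom (X Y Z : C) : dag (α_ X Y Z).hom = (α_ X Y Z).inv :=
  dag_hom_of_isUnitary (IsUnitaryMultitensorCategory.associator_unitary X Y Z)

@[simp]
theorem dag_associator_inv (X Y Z : C) : dag (α_ X Y Z).inv = (α_ X Y Z).hom :=
  dag_inv_of_isUnitary (IsUnitaryMultitensorCategory.associator_unitary X Y Z)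

@[simp]
theorem dag_leftUnitor_hom (X : C) : dag (λ_ X).hom = (λ_ X).inv :=
  dag_hom_of_isUnitary (IsUnitaryMultitensorCategory.leftUnitor_unitary X)

@[simp]
theorem dag_leftUnitor_inv (X : C) : dag (λ_ X).inv = (λ_ X).hom :=
  dag_inv_of_isUnitary (IsUnitaryMultitensorCategory.leftUnitor_unitary X)

@[simp]
theorem dag_rightUnitor_hom (X : C) : dag (ρ_ X).hom = (ρ_ X).inv :=
  dag_hom_of_isUnitary (IsUnitaryMultitensorCategory.rightUnitor_unitary X)

@[simp]
theorem dag_rightUnitor_inv (X : C) : dag (ρ_ X).inv = (ρ_ X).hom :=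
  dag_inv_of_isUnitary (IsUnitaryMultitensorCategory.rightUnitor_unitary X)

@[simp]
theorem dag_whiskerRight {X Y : C} (f : X ⟶ Y) (Z : C) : dag (f ▷ Z) = dag f ▷ Z := by
  rw [← tensorHom_id, IsUnitaryMultitensorCategory.dag_tensor, DaggerCategory.dag_id,
    tensorHom_id]

@[simp]
theorem dag_whiskerLeft (Z : C) {X Y : C} (f : X ⟶ Y) : dag (Z ◁ f) = Z ◁ dag f := by
  rw [← id_tensorHom, IsUnitaryMultitensorCategory.dag_tensor, DaggerCategory.dag_id,
    id_tensorHom]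

/-- In a C*-category `f f† = 0` forces `f = 0`, by the C*-identity. -/
theorem eq_zero_of_comp_dag_eq_zero {X Y : C} (f : X ⟶ Y) (h : f ≫ dag f = 0) : f = 0 := by
  obtain ⟨N, hN⟩ := IsCStarCategory.exists_norm (C := C)
  have h0 : N X X 0 = 0 := by simpa using hN.smul X X 0 0
  have h1 := hN.cstar X Y f
  rw [h, h0] at h1
  exact hN.eq_zero X Y f (pow_eq_zero_iff two_ne_zero |>.1 h1.symm)

end Dagger

/-! ### Snake identities and nested coevaluations -/

section Snakes

variable {C : Type*} [Category C] [MonoidalCategory C]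

theorem coevaluation_unit_comp_evaluation_unit (D : C) [H : ExactPairing (𝟙_ C) D] :
    (η_ (𝟙_ C) D ≫ (λ_ D).hom) ≫ (ρ_ D).inv ≫ ε_ (𝟙_ C) D = 𝟙 (𝟙_ C) := by
  calc
    _ = (λ_ (𝟙_ C)).inv ≫ (η_ (𝟙_ C) D ▷ 𝟙_ C ≫ (α_ _ _ _).hom ≫ 𝟙_ C ◁ ε_ (𝟙_ C) D) ≫
        (ρ_ (𝟙_ C)).hom := by monoidal
    _ = 𝟙 _ := by rw [ExactPairing.evaluation_coevaluation]; monoidal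

theorem evaluation_unit_comp_coevaluation_unit (D : C) [H : ExactPairing (𝟙_ C) D] :
    ((ρ_ D).inv ≫ ε_ (𝟙_ C) D) ≫ η_ (𝟙_ C) D ≫ (λ_ D).hom = 𝟙 D := by
  calc
    _ = 𝟙 _ ⊗≫ (ε_ (𝟙_ C) D ▷ 𝟙_ C ≫ 𝟙_ C ◁ η_ (𝟙_ C) D) ⊗≫ 𝟙 _ := by monoidal
    _ = 𝟙 _ ⊗≫ (D ◁ η_ (𝟙_ C) D ⊗≫ ε_ (𝟙_ C) D ▷ D) ⊗≫ 𝟙 _ := by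
      rw [← whisker_exchange]; monoidal
    _ = 𝟙 _ := by rw [ExactPairing.coevaluation_evaluation'']; monoidal

variable [RightRigidCategory C]

theorem coev_whiskerRight_comp_whiskerLeft_ev (c : C) : coev c ▷ c ⊗≫ c ◁ ev c = ⊗𝟙.hom :=
  ExactPairing.evaluation_coevaluation'' c cᘁ

theorem whiskerLeft_coev_comp_ev_whiskerRight (c : C) : cᘁ ◁ coev c ⊗≫ ev c ▷ cᘁ = ⊗𝟙.hom :=
  ExactPairing.coevaluation_evaluation'' c cᘁ

theorem coev_comp_whiskerLeft_rightAdjointMate {c d : C} (f : c ⟶ d) :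
    coev d ≫ d ◁ fᘁ = coev c ≫ f ▷ cᘁ :=
  coevaluation_comp_rightAdjointMate f

/-- The coevaluation `1 ⟶ (x ⊗ y) ⊗ (y^∨ ⊗ x^∨)` obtained by nesting those of `x` and `y`. -/
noncomputable def nestedCoev (x y : C) : 𝟙_ C ⟶ (x ⊗ y) ⊗ (yᘁ ⊗ xᘁ) :=
  coev x ≫ ((ρ_ x).inv ≫ x ◁ coev y ≫ (α_ x y yᘁ).inv) ▷ xᘁ ≫ (α_ (x ⊗ y) yᘁ xᘁ).hom

/-- The tensorator `ν_{y,x}` turns the nested coevaluation into that of `x ⊗ y`. -/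
theorem nestedCoev_comp_dualTensorator (x y : C) :
    nestedCoev x y ≫ (x ⊗ y) ◁ dualTensorator y x = coev (x ⊗ y) := by
  calc
    _ = 𝟙 _ ⊗≫ (nestedCoev x y ▷ 𝟙_ C ≫ _ ◁ coev (x ⊗ y)) ⊗≫
          (x ⊗ y ⊗ yᘁ) ◁ ev x ▷ (y ⊗ (x ⊗ y)ᘁ) ⊗≫
          x ◁ y ◁ ev y ▷ (x ⊗ y)ᘁ ⊗≫ 𝟙 _ := by
      rw [dualTensorator]; monoidal
    _ = coev (x ⊗ y) ⊗≫ coev x ▷ (x ⊗ y ⊗ (x ⊗ y)ᘁ) ⊗≫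
          x ◁ (coev y ▷ ((xᘁ ⊗ x) ⊗ y ⊗ (x ⊗ y)ᘁ) ≫
            (y ⊗ yᘁ) ◁ ev x ▷ (y ⊗ (x ⊗ y)ᘁ)) ⊗≫
          x ◁ y ◁ ev y ▷ (x ⊗ y)ᘁ ⊗≫ 𝟙 _ := by
      rw [← whisker_exchange, nestedCoev]; monoidal
    _ = coev (x ⊗ y) ⊗≫ (coev x ▷ x ⊗≫ x ◁ ev x) ▷ (y ⊗ (x ⊗ y)ᘁ) ⊗≫
          x ◁ (coev y ▷ y ⊗≫ y ◁ ev y) ▷ (x ⊗ y)ᘁ ⊗≫ 𝟙 _ := by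
      rw [← whisker_exchange]; monoidal
    _ = _ := by
      rw [coev_whiskerRight_comp_whiskerLeft_ev, coev_whiskerRight_comp_whiskerLeft_ev]
      monoidal

end Snakes

/-! ### Properties of the right trace -/

section Traces

variable {C : Type*} [Category C] [Preadditive C] [MonoidalCategory C] [MonoidalPreadditive C]
  [DaggerCategory C] [RightRigidCategory C]

theorem trR_sub {c : C} (f g : c ⟶ c) : trR (f - g) = trR f - trR g := by
  have h : (f - g) ▷ cᘁ = f ▷ cᘁ - g ▷ cᘁ := (tensoringRight C |>.obj cᘁ).map_sub
  simp [trR, h]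

variable [Linear ℂ C] [MonoidalLinear ℂ C] [IsUnitaryMultitensorCategory C]

theorem dag_ev_whiskerRight_comp_whiskerLeft_dag_coev (c : C) :
    dag (ev c) ▷ cᘁ ⊗≫ cᘁ ◁ dag (coev c) = ⊗𝟙.hom := by
  have h := congrArg dag (ExactPairing.coevaluation_evaluation c cᘁ)
  simp only [DaggerCategory.dag_comp, dag_whiskerLeft, dag_whiskerRight, dag_associator_inv,
    dag_rightUnitor_hom, dag_leftUnitor_inv, Category.assoc] at h
  simpa [monoidalComp, ev, coev] using h

/-- The right trace is faithful: `tr_R(f f†)` is of the form `h h†`, where `h` determines `f` by a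
snake identity. -/
theorem eq_zero_of_trR_comp_dag_eq_zero {c d : C} (f : c ⟶ d) (h : trR (f ≫ dag f) = 0) :
    f = 0 := by
  have h1 : coev c ≫ f ▷ cᘁ = 0 :=
    eq_zero_of_comp_dag_eq_zero _ (by simpa [trR] using h)
  have h2 : f = 𝟙 _ ⊗≫ (coev c ≫ f ▷ cᘁ) ▷ c ⊗≫ d ◁ ev c ⊗≫ 𝟙 _ := by
    calc
      f = 𝟙 _ ⊗≫ (coev c ▷ c ⊗≫ c ◁ ev c) ⊗≫ f ▷ 𝟙_ C ⊗≫ 𝟙 _ := by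
        rw [coev_whiskerRight_comp_whiskerLeft_ev]; monoidal
      _ = 𝟙 _ ⊗≫ coev c ▷ c ⊗≫ (c ◁ ev c ≫ f ▷ 𝟙_ C) ⊗≫ 𝟙 _ := by monoidal
      _ = _ := by rw [whisker_exchange]; monoidal
  rw [h2, h1]
  simp [monoidalComp]

/-- The partial right trace over `y` of an endomorphism of `x ⊗ y`. -/
noncomputable def ptrR {x y : C} (Z : x ⊗ y ⟶ x ⊗ y) : x ⟶ x :=
  (ρ_ x).inv ≫ x ◁ coev y ≫ (α_ x y yᘁ).inv ≫ Z ▷ yᘁ ≫ (α_ x y yᘁ).hom ≫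
    x ◁ dag (coev y) ≫ (ρ_ x).hom

section

variable [IsUnitaryDualFunctor C]

/-- The right trace is tracial because the dual functor commutes with the dagger. -/
theorem trR_comp_comm {c d : C} (f : c ⟶ d) (g : d ⟶ c) : trR (f ≫ g) = trR (g ≫ f) := by
  have h : g ▷ cᘁ ≫ dag (coev c) = d ◁ gᘁ ≫ dag (coev d) := by
    have h := congrArg dag (coev_comp_whiskerLeft_rightAdjointMate (dag g))
    simpa [IsUnitaryDualFunctor.dag_dual] using h.symm
  calc
    trR (f ≫ g) = (coev c ≫ f ▷ cᘁ) ≫ g ▷ cᘁ ≫ dag (coev c) := by simp [trR]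
    _ = (coev c ≫ f ▷ cᘁ) ≫ d ◁ gᘁ ≫ dag (coev d) := by rw [h]
    _ = (coev c ≫ c ◁ gᘁ) ≫ f ▷ dᘁ ≫ dag (coev d) := by
      simp only [Category.assoc, ← whisker_exchange_assoc]
    _ = trR (g ≫ f) := by
      rw [coev_comp_whiskerLeft_rightAdjointMate]; simp [trR]

/-- The right trace on a tensor product factors through the partial trace: this is where the
unitarity of the tensorator of the dual functor enters. -/
theorem trR_ptrR {x y : C} (Z : x ⊗ y ⟶ x ⊗ y) : trR (ptrR Z) = trR Z := by
  have hν := (IsUnitaryDualFunctor.tensorator_unitary y x).1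
  have h : trR Z = nestedCoev x y ≫ Z ▷ _ ≫ dag (nestedCoev x y) := by
    rw [trR, ← nestedCoev_comp_dualTensorator]
    simp only [DaggerCategory.dag_comp, dag_whiskerLeft, Category.assoc]
    rw [whisker_exchange_assoc, ← whiskerLeft_comp_assoc, hν]
    simp
  rw [h, trR, ptrR, nestedCoev]
  simp only [DaggerCategory.dag_comp, dag_whiskerLeft, dag_whiskerRight, dag_associator_inv,
    dag_associator_hom, dag_rightUnitor_inv]
  monoidal

/-- On `End(1)` the right trace is the identity. It is multiplication by `r = tr_R(1)`, where
`r² = r` by multiplicativity of the trace and `r` is invertible by the snake identities. -/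
theorem trR_unit (s : 𝟙_ C ⟶ 𝟙_ C) : trR s = s := by
  -- The chosen dual of `1`, as opposed to the instance that makes `1` its own dual.
  let D : C := @HasRightDual.rightDual C _ _ (𝟙_ C) (RightRigidCategory.rightDual (𝟙_ C))
  obtain ⟨r, hr⟩ : ∃ r : 𝟙_ C ⟶ 𝟙_ C, r = coev (𝟙_ C) ≫ dag (coev (𝟙_ C)) := ⟨_, rfl⟩
  have hs (s : 𝟙_ C ⟶ 𝟙_ C) : trR s = s ≫ r := by
    have : coev (𝟙_ C) ≫ s ▷ D = s ≫ coev (𝟙_ C) := by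
      calc
        _ = 𝟙 _ ⊗≫ (_ ◁ (coev (𝟙_ C) ≫ (λ_ D).hom) ≫ s ▷ D) := by monoidal
        _ = _ := by rw [whisker_exchange]; monoidal
    rw [trR, reassoc_of% this, hr]
  -- The trace of the identity of `1 ⊗ 1` is `r²` by `trR_ptrR`, and `r` because `1 ⊗ 1 ≅ 1`.
  have hrr : r ≫ r = r := by
    have h1 : ptrR (𝟙 (𝟙_ C ⊗ 𝟙_ C)) = r := by
      have : ptrR (𝟙 (𝟙_ C ⊗ 𝟙_ C)) = 𝟙 _ ⊗≫ (𝟙_ C) ◁ r ⊗≫ 𝟙 _ := by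
        rw [ptrR, hr]; monoidal
      rw [this]; monoidal
    have h2 := trR_ptrR (𝟙 (𝟙_ C ⊗ 𝟙_ C))
    rw [h1, hs, ← Iso.hom_inv_id (λ_ (𝟙_ C)), trR_comp_comm, Iso.inv_hom_id, hs,
      Category.id_comp] at h2
    exact h2
  -- `u` and `w` are the coevaluation and evaluation of `1`, read as mutually inverse morphisms
  -- between `1` and its dual.
  obtain ⟨u, hu⟩ : ∃ u : 𝟙_ C ⟶ D, u = coev (𝟙_ C) ≫ (λ_ D).hom := ⟨_, rfl⟩
  obtain ⟨w, hw⟩ : ∃ w : D ⟶ 𝟙_ C, w = (ρ_ D).inv ≫ ev (𝟙_ C) := ⟨_, rfl⟩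
  have huw : u ≫ w = 𝟙 _ := by
    rw [hu, hw]
    exact coevaluation_unit_comp_evaluation_unit D
      (H := HasRightDual.exact (self := RightRigidCategory.rightDual (𝟙_ C)))
  have hwu : w ≫ u = 𝟙 _ := by
    rw [hu, hw]
    exact evaluation_unit_comp_coevaluation_unit D
      (H := HasRightDual.exact (self := RightRigidCategory.rightDual (𝟙_ C)))
  have hru : r = u ≫ dag u := by simp [hr, hu]
  have hr1 : r ≫ dag w ≫ w = 𝟙 _ := by
    have : dag u ≫ dag w = 𝟙 _ := by rw [← DaggerCategory.dag_comp, hwu, DaggerCategory.dag_id]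
    rw [hru, Category.assoc, reassoc_of% this, huw]
  have : r = 𝟙 _ := by
    calc
      r = r ≫ r ≫ dag w ≫ w := by rw [hr1, Category.comp_id]
      _ = 𝟙 _ := by rw [reassoc_of% hrr, hr1]
  rw [hs, this, Category.comp_id]

/-- The right trace on `b^∨` is computed by the evaluation of `b`. -/
theorem trR_dual {b : C} (P : bᘁ ⟶ bᘁ) : trR P = dag (ev b) ≫ P ▷ b ≫ ev b := by
  -- Taking the trace of this endomorphism of `b^∨ ⊗ b` in two ways gives both sides.
  have h : ptrR (ev b ≫ dag (ev b) ≫ P ▷ b) = P := by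
    calc
      ptrR (ev b ≫ dag (ev b) ≫ P ▷ b)
      _ = 𝟙 (bᘁ) ⊗≫ (bᘁ ◁ coev b ⊗≫ ev b ▷ bᘁ) ⊗≫
          dag (ev b) ▷ bᘁ ⊗≫ (P ▷ (b ⊗ bᘁ) ≫ bᘁ ◁ dag (coev b)) ⊗≫ 𝟙 (bᘁ) := by
        rw [ptrR]; monoidal
      _ = 𝟙 (bᘁ) ⊗≫ (bᘁ ◁ coev b ⊗≫ ev b ▷ bᘁ) ⊗≫
          (dag (ev b) ▷ bᘁ ⊗≫ bᘁ ◁ dag (coev b)) ⊗≫ P ⊗≫ 𝟙 (bᘁ) := by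
        rw [← whisker_exchange]; monoidal
      _ = P := by
        rw [whiskerLeft_coev_comp_ev_whiskerRight, dag_ev_whiskerRight_comp_whiskerLeft_dag_coev]
        monoidal
  rw [← trR_unit (dag (ev b) ≫ P ▷ b ≫ ev b), ← Category.assoc, trR_comp_comm, ← trR_ptrR, h]

/-- For a spherical state the trace of an endomorphism of `b^∨` can also be computed by the
coevaluation of `b`: rotate it to an endomorphism of `b` and apply sphericality there. -/
theorem IsSpherical.map_trR_dual {ψ : (𝟙_ C ⟶ 𝟙_ C) →ₗ[ℂ] ℂ} (hψ : IsSpherical ψ) {b : C}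
    (P : bᘁ ⟶ bᘁ) : ψ (coev b ≫ b ◁ P ≫ dag (coev b)) = ψ (trR P) := by
  -- `P` is the dual of `Q`.
  let Q : b ⟶ b := (λ_ b).inv ≫ coev b ▷ b ≫ (b ◁ P) ▷ b ≫ (α_ b bᘁ b).hom ≫ b ◁ ev b ≫ (ρ_ b).hom
  have h1 : coev b ≫ Q ▷ bᘁ = coev b ≫ b ◁ P := by
    calc
      _ = 𝟙 _ ⊗≫ (𝟙_ C ◁ coev b ≫ (coev b ≫ b ◁ P) ▷ (b ⊗ bᘁ)) ⊗≫ b ◁ ev b ▷ bᘁ ⊗≫ 𝟙 _ := by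
        dsimp only [Q]; monoidal
      _ = (coev b ≫ b ◁ P) ⊗≫ b ◁ (bᘁ ◁ coev b ⊗≫ ev b ▷ bᘁ) ⊗≫ 𝟙 _ := by
        rw [whisker_exchange]; monoidal
      _ = _ := by rw [whiskerLeft_coev_comp_ev_whiskerRight]; monoidal
  have h2 : bᘁ ◁ Q ≫ ev b = P ▷ b ≫ ev b := by
    calc
      bᘁ ◁ Q ≫ ev b
      _ = 𝟙 (bᘁ ⊗ b) ⊗≫ bᘁ ◁ coev b ▷ b ⊗≫ bᘁ ◁ b ◁ P ▷ b ⊗≫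
          ((bᘁ ⊗ b) ◁ ev b ≫ ev b ▷ 𝟙_ C) ⊗≫ 𝟙 _ := by
        dsimp only [Q]; monoidal
      _ = 𝟙 (bᘁ ⊗ b) ⊗≫ bᘁ ◁ coev b ▷ b ⊗≫ ((bᘁ ⊗ b) ◁ P ≫ ev b ▷ bᘁ) ▷ b ⊗≫ ev b := by
        rw [whisker_exchange]; monoidal
      _ = 𝟙 (bᘁ ⊗ b) ⊗≫ (bᘁ ◁ coev b ⊗≫ ev b ▷ bᘁ) ▷ b ⊗≫ P ▷ b ⊗≫ ev b := by
        rw [whisker_exchange]; monoidal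
      _ = _ := by rw [whiskerLeft_coev_comp_ev_whiskerRight]; monoidal
  rw [trR_dual, ← h2, ← reassoc_of% h1]
  exact (hψ b Q).symm

end

end Traces

/-! ### Half-braidings and rotations -/

section HalfBraidings

variable {C : Type*} [Category C] [MonoidalCategory C]

theorem halfBraiding_unit {x : C} (h : HalfBraiding x) :
    (h.β (𝟙_ C)).hom = (ρ_ x).hom ≫ (λ_ x).inv := by
  let X : Center C := ⟨x, h⟩
  have hX : (β_ X (𝟙_ (Center C))).hom.f = (ρ_ X.1).hom ≫ (λ_ X.1).inv := by
    rw [braiding_tensorUnit_right, Center.comp_f, Center.rightUnitor_hom_f,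
      Center.leftUnitor_inv_f]
    rfl
  exact hX

variable [RightRigidCategory C]

/-- Passing `x` across the cup `coev_b`: the half-braiding with `b` turns into the inverse of the
half-braiding with `b^∨`. -/
theorem coev_comp_halfBraiding {x : C} (h : HalfBraiding x) (b : C) :
    (ρ_ x).inv ≫ x ◁ coev b ≫ (α_ x b bᘁ).inv ≫ (h.β b).hom ▷ bᘁ ≫ (α_ b x bᘁ).hom =
      (λ_ x).inv ≫ coev b ▷ x ≫ (α_ b bᘁ x).hom ≫ b ◁ (h.β bᘁ).inv := by
  have h1 := h.naturality (coev b)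
  rw [halfBraiding_unit, h.monoidal] at h1
  rw [← cancel_mono (b ◁ (h.β bᘁ).hom), ← cancel_mono (α_ b bᘁ x).inv, ← cancel_epi (ρ_ x).hom]
  simpa using h1

variable [DaggerCategory C]

/-- Bend the leg `b` of `f : x ⟶ a ⊗ b` down on the right, by means of `coev_b†`. -/
noncomputable def bendRight {x a b : C} (f : x ⟶ a ⊗ b) : x ⊗ bᘁ ⟶ a :=
  f ▷ bᘁ ≫ (α_ a b bᘁ).hom ≫ a ◁ dag (coev b) ≫ (ρ_ a).hom

/-- Bend the leg `b^∨` of `g : b^∨ ⊗ x ⟶ a` up on the left, by means of `coev_b`. -/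
noncomputable def bendLeft {x a b : C} (g : bᘁ ⊗ x ⟶ a) : x ⟶ b ⊗ a :=
  (λ_ x).inv ≫ coev b ▷ x ≫ (α_ b bᘁ x).hom ≫ b ◁ g

/-- The rotation of `f : x ⟶ a ⊗ b` to a morphism `x ⟶ b ⊗ a` that carries the leg `b` around `x`
by means of a half-braiding of `x`. -/
noncomputable def rotate {x a b : C} (h : HalfBraiding x) (f : x ⟶ a ⊗ b) : x ⟶ b ⊗ a :=
  (ρ_ x).inv ≫ x ◁ coev b ≫ (α_ x b bᘁ).inv ≫ (h.β b).hom ▷ bᘁ ≫ (b ◁ f) ▷ bᘁ ≫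
    (α_ b (a ⊗ b) bᘁ).hom ≫ b ◁ ((α_ a b bᘁ).hom ≫ a ◁ dag (coev b) ≫ (ρ_ a).hom)

theorem rotate_eq_bendLeft {x a b : C} (h : HalfBraiding x) (f : x ⟶ a ⊗ b) :
    rotate h f = bendLeft ((h.β bᘁ).inv ≫ bendRight f) := by
  calc
    rotate h f = ((ρ_ x).inv ≫ x ◁ coev b ≫ (α_ x b bᘁ).inv ≫ (h.β b).hom ▷ bᘁ ≫
        (α_ b x bᘁ).hom) ≫ b ◁ bendRight f := by
      simp [rotate, bendRight]
    _ = _ := by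
      rw [coev_comp_halfBraiding]; simp [bendLeft]

/-- The rotation is natural for morphisms of the Drinfeld center. -/
theorem rotate_comp {x x' a b : C} (h : HalfBraiding x) (h' : HalfBraiding x') (g : x ⟶ x')
    (hg : g ▷ b ≫ (h'.β b).hom = (h.β b).hom ≫ b ◁ g) (f : x' ⟶ a ⊗ b) :
    rotate h (g ≫ f) = g ≫ rotate h' f := by
  symm
  calc
    g ≫ rotate h' f = 𝟙 _ ⊗≫ (g ▷ 𝟙_ C ≫ x' ◁ coev b) ⊗≫ (h'.β b).hom ▷ bᘁ ⊗≫
          (b ◁ f) ▷ bᘁ ⊗≫ (b ⊗ a) ◁ dag (coev b) ⊗≫ 𝟙 _ := by rw [rotate]; monoidal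
    _ = 𝟙 _ ⊗≫ x ◁ coev b ⊗≫ (g ▷ b ≫ (h'.β b).hom) ▷ bᘁ ⊗≫
          (b ◁ f) ▷ bᘁ ⊗≫ (b ⊗ a) ◁ dag (coev b) ⊗≫ 𝟙 _ := by
      rw [← whisker_exchange]; monoidal
    _ = rotate h (g ≫ f) := by
      rw [hg, rotate]; monoidal

end HalfBraidings

/-! ### Rotations are isometric -/

section Rotations

variable {C : Type*} [Category C] [Preadditive C] [Linear ℂ C]
  [MonoidalCategory C] [MonoidalPreadditive C] [MonoidalLinear ℂ C] [DaggerCategory C]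
  [IsUnitaryMultitensorCategory C] [RightRigidCategory C] [IsUnitaryDualFunctor C]

/-- Bending on the right preserves the inner product: after a cyclic permutation, the morphism to
be traced is a partial trace. -/
theorem trR_bendRight {x a b : C} (f f' : x ⟶ a ⊗ b) :
    trR (bendRight f ≫ dag (bendRight f')) = trR (f ≫ dag f') := by
  have h : dag (bendRight f') ≫ bendRight f = ptrR (dag f' ≫ f) := by
    simp [bendRight, ptrR]
  rw [trR_comp_comm, h, trR_ptrR, trR_comp_comm]

/-- Bending on the left preserves the inner product of a spherical state; the left partial trace
that appears closes up with `coev_b` and not with the evaluation of `b^∨`, which is compensated by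
sphericality. -/
theorem IsSpherical.map_trR_bendLeft {ψ : (𝟙_ C ⟶ 𝟙_ C) →ₗ[ℂ] ℂ} (hψ : IsSpherical ψ)
    {x a b : C} (g g' : bᘁ ⊗ x ⟶ a) :
    ψ (trR (bendLeft g ≫ dag (bendLeft g'))) = ψ (trR (g ≫ dag g')) := by
  have h : trR (bendLeft g ≫ dag (bendLeft g')) =
      coev b ≫ b ◁ ptrR (g ≫ dag g') ≫ dag (coev b) := by
    calc
      _ = 𝟙 _ ⊗≫ (𝟙_ C ◁ coev x ≫ coev b ▷ (x ⊗ xᘁ)) ⊗≫ b ◁ (g ≫ dag g') ▷ xᘁ ⊗≫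
          (dag (coev b) ▷ (x ⊗ xᘁ) ≫ 𝟙_ C ◁ dag (coev x)) ⊗≫ 𝟙 _ := by
        simp only [trR, bendLeft, DaggerCategory.dag_comp, dag_whiskerLeft, dag_whiskerRight,
          dag_associator_hom, dag_leftUnitor_inv]
        monoidal
      _ = _ := by
        rw [whisker_exchange (coev b) (coev x),
          ← whisker_exchange (dag (coev b)) (dag (coev x)), ptrR]
        monoidal
  rw [h, hψ.map_trR_dual, trR_ptrR]

/-- The rotation along a unitary half-braiding is isometric for a spherical state. -/
theorem IsSpherical.map_trR_rotate {ψ : (𝟙_ C ⟶ 𝟙_ C) →ₗ[ℂ] ℂ} (hψ : IsSpherical ψ)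
    {x a b : C} (h : HalfBraiding x) (hu : IsUnitary (h.β bᘁ).hom) (f f' : x ⟶ a ⊗ b) :
    ψ (trR (rotate h f ≫ dag (rotate h f'))) = ψ (trR (f ≫ dag f')) := by
  rw [rotate_eq_bendLeft, rotate_eq_bendLeft, hψ.map_trR_bendLeft, DaggerCategory.dag_comp,
    dag_inv_of_isUnitary hu, Category.assoc, trR_comp_comm]
  simp [trR_bendRight]

end Rotations

/-! ### Unitarity of the traciator -/

section Traciator

variable {V : Type*} [Category V] [Preadditive V] [Linear ℂ V] [MonoidalCategory V]
  [DaggerCategory V] [BraidedCategory V] [RightRigidCategory V]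
  {C : Type*} [Category C] [Preadditive C] [Linear ℂ C] [MonoidalCategory C]
  [DaggerCategory C] [RightRigidCategory C]
  (M : UnitaryModuleStructure V C) {Tr : C ⥤ V} (adj : M.Φ ⊣ Tr)

/-- The half-braiding `e_{Φ(v),-}` as a term of Mathlib's type of half-braidings on `Φ(v)`. -/
def UnitaryModuleStructure.centralStructure (v : V) : HalfBraiding (M.Φ.obj v) :=
  (M.ΦZ.obj v).2

/-- Under the adjunction, composition with the traciator is the rotation. -/
theorem homEquiv_comp_traciator (a b : C) {v : V} (f : M.Φ.obj v ⟶ a ⊗ b) :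
    adj.homEquiv v _ f ≫ M.traciator adj a b =
      adj.homEquiv v _ (rotate (M.centralStructure v) f) := by
  let p := adj.homEquiv v _ f
  have hf : f = M.Φ.map p ≫ adj.counit.app (a ⊗ b) :=
    ((adj.homEquiv v (a ⊗ b)).symm_apply_apply f).symm.trans (adj.homEquiv_counit v (a ⊗ b) p)
  rw [UnitaryModuleStructure.traciator, ← adj.homEquiv_naturality_left]
  congr 1
  conv_rhs => rw [hf]
  exact (rotate_comp (M.centralStructure v) (M.centralStructure (Tr.obj (a ⊗ b))) (M.Φ.map p)
    ((M.ΦZ.map p).comm b) (adj.counit.app (a ⊗ b))).symm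

variable [MonoidalPreadditive V] [MonoidalLinear ℂ V] [IsBraidedUnitaryTensorCategory V]
  [MonoidalPreadditive C] [MonoidalLinear ℂ C] [IsUnitaryMultitensorCategory C]
  [IsUnitaryDualFunctor C] {adj}

/-- The traciator is an isometry: rotation preserves the inner products, and the trace of `V` is
faithful. -/
theorem traciator_comp_dag (hadj : M.IsUnitaryAdjunction adj) (hψ : IsSpherical M.ψ) (a b : C) :
    M.traciator adj a b ≫ dag (M.traciator adj a b) = 𝟙 _ := by
  -- `⟨τ, q τ⟩ = ⟨1, q⟩`, by comparing the inner products of the mates of `1` and `q` before and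
  -- after rotation.
  have key (q : Tr.obj (a ⊗ b) ⟶ Tr.obj (a ⊗ b)) :
      trR (M.traciator adj a b ≫ dag (M.traciator adj a b) ≫ dag q) = trR (dag q) := by
    have h1 := hadj _ _
      (rotate (M.centralStructure (Tr.obj (a ⊗ b))) ((adj.homEquiv _ _).symm (𝟙 _)))
      (rotate (M.centralStructure (Tr.obj (a ⊗ b))) ((adj.homEquiv _ _).symm q))
    have h2 := hadj _ _ ((adj.homEquiv _ (a ⊗ b)).symm (𝟙 _)) ((adj.homEquiv _ _).symm q)
    have h3 := hψ.map_trR_rotate _ (M.halfBraiding_unitary (Tr.obj (a ⊗ b)) bᘁ)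
      ((adj.homEquiv _ (a ⊗ b)).symm (𝟙 _)) ((adj.homEquiv _ _).symm q)
    rw [← homEquiv_comp_traciator, ← homEquiv_comp_traciator, Equiv.apply_symm_apply,
      Equiv.apply_symm_apply] at h1
    rw [Equiv.apply_symm_apply, Equiv.apply_symm_apply] at h2
    have h4 := h1.trans ((congrArg (· • 𝟙 (𝟙_ V)) h3).trans h2.symm)
    simpa using h4
  rw [← sub_eq_zero]
  apply eq_zero_of_trR_comp_dag_eq_zero
  rw [Preadditive.sub_comp, trR_sub, Category.assoc, key, Category.id_comp, sub_self]

/-- An isometry is unitary once composition with it is surjective on Hom spaces, and that follows by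
comparing dimensions. -/
theorem traciator_isUnitary (hadj : M.IsUnitaryAdjunction adj) (hψ : IsSpherical M.ψ) (a b : C) :
    IsUnitary (M.traciator adj a b) := by
  refine ⟨traciator_comp_dag M hadj hψ a b, ?_⟩
  have hfin (X Y : V) : Module.Finite ℂ (X ⟶ Y) := IsUnitaryMultitensorCategory.finite_hom X Y
  have hinj (c d : C) (v : V) :
      Function.Injective (Linear.rightComp ℂ v (M.traciator adj c d)) := fun f g h => by
    have h' : f ≫ M.traciator adj c d = g ≫ M.traciator adj c d := h
    simpa [traciator_comp_dag M hadj hψ] using congrArg (· ≫ dag (M.traciator adj c d)) h'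
  -- The traciators in both directions are isometric, so the Hom spaces have equal dimension.
  have hdim := le_antisymm (LinearMap.finrank_le_finrank_of_injective (hinj a b (Tr.obj (b ⊗ a))))
    (LinearMap.finrank_le_finrank_of_injective (hinj b a (Tr.obj (b ⊗ a))))
  obtain ⟨p, hp⟩ := (LinearMap.injective_iff_surjective_of_finrank_eq_finrank hdim).1
    (hinj a b (Tr.obj (b ⊗ a))) (𝟙 _)
  have hp' : p ≫ M.traciator adj a b = 𝟙 _ := hp
  -- A left inverse and a right inverse of the traciator coincide.
  have : p = dag (M.traciator adj a b) := by
    simpa [traciator_comp_dag M hadj hψ] using congrArg (· ≫ dag (M.traciator adj a b)) hp'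
  rw [← this, hp']

end Traciator

end UnitaryTraciator

theorem mainTheorem5
    {V : Type*} [CategoryTheory.Category V] [Preadditive V] [Linear ℂ V]
    [MonoidalCategory V] [MonoidalPreadditive V] [MonoidalLinear ℂ V]
    [UnitaryTraciator.DaggerCategory V] [BraidedCategory V]
    [UnitaryTraciator.IsBraidedUnitaryTensorCategory V]
    [RightRigidCategory V] [UnitaryTraciator.IsUnitaryDualFunctor V]
    {C : Type*} [CategoryTheory.Category C] [Preadditive C] [Linear ℂ C]
    [MonoidalCategory C] [MonoidalPreadditive C] [MonoidalLinear ℂ C]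
    [UnitaryTraciator.DaggerCategory C]
    [UnitaryTraciator.IsUnitaryMultitensorCategory C]
    [RightRigidCategory C] [UnitaryTraciator.IsUnitaryDualFunctor C]
    (M : UnitaryTraciator.UnitaryModuleStructure V C)
    (Tr : C ⥤ V) (adj : M.Φ ⊣ Tr) (hadj : M.IsUnitaryAdjunction adj)
    (hψ : UnitaryTraciator.IsSpherical M.ψ) (a b : C) :
    UnitaryTraciator.IsUnitary (M.traciator adj a b) :=
  UnitaryTraciator.traciator_isUnitary M hadj hψ a b
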